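/- Let $K,r_0,r_1\ge 0$ be integers and let $Q$ be the generalized Kronecker quiver with two vertices $0,1$ and $K$ arrows from $0$ to $1$, with dimension vector $(r_0,r_1)$. Its representation space is $\mathrm{Mat}(r_1\times r_0)^{K}$ over $\mathbb{C}$, with coordinates $x^i_{jk}$ ($1\le i\le K$, $1\le j\le r_1$, $1\le k\le r_0$), where $x^i_{jk}$ is the $(j,k)$ entry of the $i$-th matrix $M_i$. The group $GL(r_0)\times GL(r_1)$ acts by $(g_0,g_1)\cdot (M_i)_i=(g_1M_ig_0^{-1})_i$, and a polynomial $f$ in the $x^i_{jk}$ is a semi-invariant if there are integers $\theta_0,\theta_1$ such that $f(g\cdot M)=\det(g_0)^{\theta_0}\det(g_1)^{\theta_1}f(M)$ for all $g=(g_0,g_1)$. Fix the lexicographic term order on $\mathbb{C}[x^i_{jk}]$ in which the variables decrease along the rows of $M_1$ (first row, second row, and so on), then along the rows of $M_2$, and so forth: $x^1_{11}>x^1_{12}>\cdots>x^1_{1r_0}>x^1_{21}>\cdots>x^2_{11}>\cdots$. Consider a rectangular tableau $T^+$ with $r_1$ rows and $w^+\ge 0$ columns, filled with labels $(i,k)\in\{1,\dots,K\}\times\{1,\dots,r_0\}$,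 and a rectangular tableau $T^-$ with $r_0$ rows and $w^-\ge 0$ columns, filled with labels $(i,j)\in\{1,\dots,K\}\times\{1,\dots,r_1\}$. The pair $(T^+,T^-)$ is linked if there is a bijection from the boxes of $T^+$ to the boxes of $T^-$ that takes each box with label $(i,k)$ in row $j$ of $T^+$ to a box with label $(i,j)$ in row $k$ of $T^-$. Order labels lexicographically; a tableau is semi-standard if its labels increase weakly along rows and strictly down columns, and a linked pair is semi-standard if both tableaux are. Put $$\mathrm{Mon}(T^+)=\prod x^i_{jk},$$ the product over all boxes of $T^+$, where $(i,k)$ is the label of the box and $j$ its row, and $$\mathrm{Mon}(T^-)=\prod x^i_{jk},$$ the product over all boxes of $T^-$, where $(i,j)$ is the label of the box and $k$ its row. Then for every nonzero semi-invariant $f$ there is a semi-standard linked pair of tableaux $(T^+,T^-)$ (for some $w^+,w^-$) such that the leading monomial of $f$ is $$\mathrm{LM}(f)=\mathrm{Mon}(T^+)=\mathrm{Mon}(T^-).$$ -/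

import Mathlib

noncomputable section

namespace Kronecker

open MvPolynomial

/-- Index set of the coordinates `x^i_{jk}` on `Rep(Q, (r₀, r₁)) = Mat(r₁ × r₀)^K`, where `Q` has
`K` arrows `0 ⟶ 1`: `(i, j, k)` stands for the `(j, k)` entry of the `i`-th matrix. The order is
lexicographic in `(i, j, k)`, i.e. one goes along the rows of the first matrix, then along the
rows of the second one, and so on. -/
abbrev Coord (K r₀ r₁ : ℕ) : Type := Fin K ×ₗ (Fin r₁ ×ₗ Fin r₀)

/-- The coordinate `(i, j, k)`. -/
def coord {K r₀ r₁ : ℕ} (i : Fin K) (j : Fin r₁) (k : Fin r₀) : Coord K r₀ r₁ :=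
  toLex (i, toLex (j, k))

/-- The coordinate ring `ℂ[Rep(Q, (r₀, r₁))]`. -/
abbrev CoordRing (K r₀ r₁ : ℕ) : Type := MvPolynomial (Coord K r₀ r₁) ℂ

/-- The matrix of coordinates `M_i = (x^i_{jk})` of the `i`-th arrow. -/
def genericMatrix {K r₀ r₁ : ℕ} (i : Fin K) :
    Matrix (Fin r₁) (Fin r₀) (CoordRing K r₀ r₁) :=
  Matrix.of fun j k => X (coord i j k)

/-- The matrix `g₁ M_i g₀⁻¹` for `g = (g₀, g₁) ∈ GL(r₀) × GL(r₁)`: the `i`-th matrix of `g · M`. -/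
def transformedMatrix {K r₀ r₁ : ℕ} (g : GL (Fin r₀) ℂ × GL (Fin r₁) ℂ) (i : Fin K) :
    Matrix (Fin r₁) (Fin r₀) (CoordRing K r₀ r₁) :=
  Matrix.map (g.2 : Matrix (Fin r₁) (Fin r₁) ℂ) (C : ℂ →+* CoordRing K r₀ r₁) *
    (genericMatrix i : Matrix (Fin r₁) (Fin r₀) (CoordRing K r₀ r₁)) *
    Matrix.map ((g.1⁻¹ : GL (Fin r₀) ℂ) : Matrix (Fin r₀) (Fin r₀) ℂ)
      (C : ℂ →+* CoordRing K r₀ r₁)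

/-- Change of basis `f ↦ f(g · M)`, where `(g · M)_i = g₁ M_i g₀⁻¹`. -/
def changeBasis {K r₀ r₁ : ℕ} (g : GL (Fin r₀) ℂ × GL (Fin r₁) ℂ) :
    CoordRing K r₀ r₁ →ₐ[ℂ] CoordRing K r₀ r₁ :=
  aeval fun v : Coord K r₀ r₁ =>
    transformedMatrix g (ofLex v).1 (ofLex (ofLex v).2).1 (ofLex (ofLex v).2).2

/-- The character `χ_θ(g) = det(g₀)^θ₀ det(g₁)^θ₁` of `GL(r₀) × GL(r₁)`. -/
def character {r₀ r₁ : ℕ} (θ : ℤ × ℤ) (g : GL (Fin r₀) ℂ × GL (Fin r₁) ℂ) : ℂ :=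
  (g.1 : Matrix (Fin r₀) (Fin r₀) ℂ).det ^ θ.1 * (g.2 : Matrix (Fin r₁) (Fin r₁) ℂ).det ^ θ.2

/-- `f` is a semi-invariant of weight `θ`: `f(g · M) = χ_θ(g) f(M)` for all `g`. (With the
inverse convention `f(g⁻¹ · M)` for the action on functions, the weight is `-θ` instead.) -/
def IsSemiInvariant {K r₀ r₁ : ℕ} (θ : ℤ × ℤ) (f : CoordRing K r₀ r₁) : Prop :=
  ∀ g : GL (Fin r₀) ℂ × GL (Fin r₁) ℂ, changeBasis g f = C (character θ g) * f

/-- The leading monomial for the lexicographic term order with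
`x^1_{11} > x^1_{12} > ⋯ > x^1_{1 r₀} > x^1_{21} > ⋯ > x^2_{11} > ⋯`. -/
def leadingMonomial {K r₀ r₁ : ℕ} (f : CoordRing K r₀ r₁) : CoordRing K r₀ r₁ :=
  monomial (MonomialOrder.lex.degree f) 1

/-- Labels `(i, j)` with `i ∈ {1, …, K}` and `j ∈ {1, …, r}`, ordered lexicographically. -/
abbrev Label (K r : ℕ) : Type := Fin K ×ₗ Fin r

/-- First component of a label: the arrow. -/
def Label.arrow {K r : ℕ} (a : Label K r) : Fin K := (ofLex a).1

/-- Second component of a label. -/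
def Label.index {K r : ℕ} (a : Label K r) : Fin r := (ofLex a).2

/-- Fillings of the rectangle with `r` rows and `w` columns; `T p c` is the entry in row `p` and
column `c`. -/
abbrev Tableau (r w : ℕ) (α : Type) : Type := Fin r → Fin w → α

/-- Weakly increasing along rows and strictly increasing down columns. -/
def IsSemistandard {r w : ℕ} {α : Type} [Preorder α] (T : Tableau r w α) : Prop :=
  (∀ p, Monotone (T p)) ∧ ∀ c, StrictMono fun p => T p c

/-- `Mon(T⁺)`: a label `(i, k)` in row `j` contributes `(M_i)_{jk}`. -/
def monPlus {K r₀ r₁ w : ℕ} (T : Tableau r₁ w (Label K r₀)) : CoordRing K r₀ r₁ :=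
  ∏ j : Fin r₁, ∏ c : Fin w, genericMatrix (T j c).arrow j (T j c).index

/-- `Mon(T⁻)`: a label `(i, j)` in row `k` contributes `(M_i)_{jk}`. -/
def monMinus {K r₀ r₁ w : ℕ} (T : Tableau r₀ w (Label K r₁)) : CoordRing K r₀ r₁ :=
  ∏ k : Fin r₀, ∏ c : Fin w, genericMatrix (T k c).arrow (T k c).index k

/-- A link: a bijection from the boxes of `T⁺` to the boxes of `T⁻` such that, whenever a box in
row `p` of `T⁺` with label `(i, j)` goes to a box in row `q` of `T⁻` with label `(k, l)`, one has
`i = k`, `p = l` and `q = j`. -/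
def IsLink {K r₀ r₁ wp wm : ℕ} (Tp : Tableau r₁ wp (Label K r₀))
    (Tm : Tableau r₀ wm (Label K r₁)) (σ : Fin r₁ × Fin wp ≃ Fin r₀ × Fin wm) : Prop :=
  ∀ b : Fin r₁ × Fin wp,
    (Tp b.1 b.2).arrow = (Tm (σ b).1 (σ b).2).arrow ∧
    b.1 = (Tm (σ b).1 (σ b).2).index ∧
    (σ b).1 = (Tp b.1 b.2).index

/-- `T⁺` and `T⁻` form a linked pair. -/
def IsLinkedPair {K r₀ r₁ wp wm : ℕ} (Tp : Tableau r₁ wp (Label K r₀))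
    (Tm : Tableau r₀ wm (Label K r₁)) : Prop :=
  ∃ σ : Fin r₁ × Fin wp ≃ Fin r₀ × Fin wm, IsLink Tp Tm σ

/-- A linked pair is semi-standard if both of its tableaux are. -/
def IsSemistandardLinkedPair {K r₀ r₁ wp wm : ℕ} (Tp : Tableau r₁ wp (Label K r₀))
    (Tm : Tableau r₀ wm (Label K r₁)) : Prop :=
  IsLinkedPair Tp Tm ∧ IsSemistandard Tp ∧ IsSemistandard Tm

end Kronecker

end

/-! A semi-invariant is fixed by adding one row to another, since transvections have determinant
one. Diagonal matrices show that all its monomials have the same degree `w` in each row of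
coordinates. The same holds for columns. Hence one statement about row operations, applied once to
rows and once to columns, gives both tableaux.

Let `m` be the leading exponent and `p < p'`. A semistandard tableau whose row `p` has content `m
(p, ·)` exists as soon as, for every label `l`, row `p'` has at most as many entries `≤ l` as row
`p` has entries `< l`. To prove this inequality (`sum_le_sum_of_addRow_invariant`), apply
`specialize` to `F` and to its equal, the row-transformed `F`. Let `M` be `m` with its exponent at
`(p, l)` moved to `(p', l)`. On the transformed side `M` can come only from `m`, by maximality of
`m` and equality of the row degrees, so its coefficient is nonzero. On the other side, a weight that
each variable of row `p'` raises by at most one, and no other variable raises, is at most `w` on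
every monomial. Evaluating it on `M` gives the inequality.

Both tableaux record the same exponent `m`, so their boxes above each coordinate are equinumerous;
matching them gives the link. -/

noncomputable section

namespace Kronecker

open MvPolynomial

/-! ### Weight bounds and initial forms of polynomials -/

section Weights

variable {σ R : Type*} [Fintype σ] [CommRing R]

/-- Every monomial of `p` has weight at most `κ`, where the variable `v` has weight `W v`. -/
def WeightLE (W : σ → ℤ) (κ : ℤ) (p : MvPolynomial σ R) : Prop :=
  ∀ d ∈ p.support, ∑ v, (d v : ℤ) * W v ≤ κ

namespace WeightLE

variable {W : σ → ℤ} {κ κ' : ℤ} {p q : MvPolynomial σ R}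

lemma mono (h : WeightLE W κ p) (hκ : κ ≤ κ') : WeightLE W κ' p :=
  fun d hd => (h d hd).trans hκ

lemma zero : WeightLE W κ (0 : MvPolynomial σ R) := by
  intro d hd
  simp at hd

lemma add (hp : WeightLE W κ p) (hq : WeightLE W κ q) : WeightLE W κ (p + q) := by
  classical
  intro d hd
  rcases Finset.mem_union.1 (support_add hd) with h | h
  exacts [hp d h, hq d h]

lemma neg (hp : WeightLE W κ p) : WeightLE W κ (-p) := by
  intro d hd
  rw [support_neg] at hd
  exact hp d hd

lemma const (c : R) : WeightLE W 0 (C c : MvPolynomial σ R) := by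
  classical
  intro d hd
  rw [mem_support_iff, coeff_C] at hd
  have : (0 : σ →₀ ℕ) = d := by
    by_contra h
    simp [h] at hd
  simp [← this]

lemma var {v : σ} (h : W v ≤ κ) : WeightLE W κ (X v : MvPolynomial σ R) := by
  classical
  intro d hd
  rw [mem_support_iff, coeff_X] at hd
  have : Finsupp.single v 1 = d := by
    by_contra h
    simp [h] at hd
  subst this
  simpa [Finsupp.single_apply] using h

lemma mul (hp : WeightLE W κ p) (hq : WeightLE W κ' q) : WeightLE W (κ + κ') (p * q) := by
  classical
  intro d hd
  obtain ⟨a, ha, b, hb, rfl⟩ := Finset.mem_add.1 (support_mul p q hd)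
  have := add_le_add (hp a ha) (hq b hb)
  simpa [add_mul, Finset.sum_add_distrib] using this

/-- Passing to initial forms is multiplicative. -/
lemma mul_sub_mul {p' q' : MvPolynomial σ R} (hp : WeightLE W κ p)
    (hq' : WeightLE W κ' q') (h : WeightLE W (κ - 1) (p - q)) (h' : WeightLE W (κ' - 1) (p' - q')) :
    WeightLE W (κ + κ' - 1) (p * p' - q * q') := by
  have e : p * p' - q * q' = p * (p' - q') + (p - q) * q' := by ring
  rw [e]
  exact ((hp.mul h').mono (by linarith)).add ((h.mul hq').mono (by linarith))

lemma pow (hp : WeightLE W κ p) (n : ℕ) : WeightLE W (n * κ) (p ^ n) := by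
  induction n with
  | zero => simpa using const (W := W) (1 : R)
  | succ n ih =>
    rw [pow_succ]
    exact (ih.mul hp).mono (by push_cast; linarith)

lemma pow_sub_pow (hp : WeightLE W κ p) (hq : WeightLE W κ q) (h : WeightLE W (κ - 1) (p - q))
    (n : ℕ) : WeightLE W (n * κ - 1) (p ^ n - q ^ n) := by
  induction n with
  | zero => simpa using zero
  | succ n ih =>
    rw [pow_succ, pow_succ]
    exact (mul_sub_mul (hp.pow n) hq ih h).mono (by push_cast; linarith)

lemma prod {ι : Type*} (s : Finset ι) {P : ι → MvPolynomial σ R} {k : ι → ℤ}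
    (hP : ∀ i, WeightLE W (k i) (P i)) : WeightLE W (∑ i ∈ s, k i) (∏ i ∈ s, P i) := by
  classical
  induction s using Finset.induction_on with
  | empty => simpa using const (W := W) (1 : R)
  | insert a s ha ih =>
    rw [Finset.prod_insert ha, Finset.sum_insert ha]
    exact (hP a).mul ih

lemma prod_sub_prod {ι : Type*} (s : Finset ι) {P Q : ι → MvPolynomial σ R} {k : ι → ℤ}
    (hP : ∀ i, WeightLE W (k i) (P i)) (hQ : ∀ i, WeightLE W (k i) (Q i))
    (h : ∀ i, WeightLE W (k i - 1) (P i - Q i)) :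
    WeightLE W (∑ i ∈ s, k i - 1) (∏ i ∈ s, P i - ∏ i ∈ s, Q i) := by
  classical
  induction s using Finset.induction_on with
  | empty => simpa using zero
  | insert a s ha ih =>
    rw [Finset.prod_insert ha, Finset.prod_insert ha, Finset.sum_insert ha]
    exact mul_sub_mul (hP a) (prod s hQ) (h a) ih

lemma aeval_monomial {Φ : σ → MvPolynomial σ R} {k : σ → ℤ} (h : ∀ v, WeightLE W (k v) (Φ v))
    (μ : σ →₀ ℕ) (c : R) : WeightLE W (∑ v, (μ v : ℤ) * k v) (aeval Φ (monomial μ c)) := by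
  rw [MvPolynomial.aeval_monomial, Finsupp.prod_fintype _ _ (by simp)]
  exact ((const c).mul (prod _ fun v => (h v).pow (μ v))).mono (by simp)

lemma aeval_monomial_sub {Φ Ψ : σ → MvPolynomial σ R} {k : σ → ℤ}
    (hΦ : ∀ v, WeightLE W (k v) (Φ v)) (hΨ : ∀ v, WeightLE W (k v) (Ψ v))
    (h : ∀ v, WeightLE W (k v - 1) (Φ v - Ψ v)) (μ : σ →₀ ℕ) (c : R) :
    WeightLE W (∑ v, (μ v : ℤ) * k v - 1)
      (aeval Φ (monomial μ c) - aeval Ψ (monomial μ c)) := by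
  rw [MvPolynomial.aeval_monomial, MvPolynomial.aeval_monomial,
    Finsupp.prod_fintype _ _ (by simp), Finsupp.prod_fintype _ _ (by simp), ← mul_sub]
  exact ((const c).mul (prod_sub_prod _ (fun v => (hΦ v).pow (μ v)) (fun v => (hΨ v).pow (μ v))
    fun v => (hΦ v).pow_sub_pow (hΨ v) (h v) (μ v))).mono (by simp)

end WeightLE

end Weights

lemma exists_mem_support_of_coeff_aeval_ne_zero {σ R : Type*} [CommRing R] {Φ : σ → MvPolynomial σ R}
    {F : MvPolynomial σ R} {d : σ →₀ ℕ} (h : coeff d (aeval Φ F) ≠ 0) :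
    ∃ μ ∈ F.support, d ∈ (aeval Φ (monomial μ (coeff μ F))).support := by
  conv at h => rw [F.as_sum, map_sum, coeff_sum]
  obtain ⟨μ, hμ, hd⟩ := Finset.exists_ne_zero_of_sum_ne_zero h
  exact ⟨μ, hμ, mem_support_iff.2 hd⟩

/-! ### The lattice word inequality from invariance under a row operation -/

section Ballot

variable {ι L R : Type*} [DecidableEq ι] [CommRing R]

/-- The substitution adding row `p'` to row `p`. -/
def addRow (R : Type*) [CommRing R] (p p' : ι) (v : ι × L) : MvPolynomial (ι × L) R :=
  if v.1 = p then X v + X (p', v.2) else X v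

variable [LinearOrder L]

/-- A specialization of the rows `p` and `p'` which is the identity on the columns before `l`, kills
the entry `(p, l)`, and is unimodular on each column after `l`. -/
def specialize (R : Type*) [CommRing R] (p p' : ι) (l : L) (v : ι × L) : MvPolynomial (ι × L) R :=
  if v.1 = p then if v.2 < l then X v else if v.2 = l then 0 else -X (p', v.2)
  else if v.1 = p' ∧ l < v.2 then X (p, v.2) + X v else X v

/-- The composition of `addRow` and `specialize`. -/
def addRowSpecialize (R : Type*) [CommRing R] (p p' : ι) (l : L) (v : ι × L) :
    MvPolynomial (ι × L) R :=
  if v.1 = p then if v.2 < l then X v + X (p', v.2) else if v.2 = l then X (p', v.2) else X v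
  else if v.1 = p' ∧ l < v.2 then X (p, v.2) + X v else X v

/-- Moves the entry `(p, l)` to `(p', l)`. -/
def mergeEntry (p p' : ι) (l : L) (v : ι × L) : ι × L :=
  if v.1 = p ∧ v.2 = l then (p', l) else v

lemma aeval_specialize_addRow {p p' : ι} (hp : p ≠ p') (l : L) (F : MvPolynomial (ι × L) R) :
    aeval (specialize R p p' l) (aeval (addRow R p p') F) = aeval (addRowSpecialize R p p' l) F := by
  rw [← AlgHom.comp_apply]
  congr 1
  ext1 v
  obtain ⟨q, i⟩ := v
  rw [AlgHom.comp_apply, aeval_X, aeval_X]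
  by_cases hq : q = p
  · subst hq
    rcases lt_trichotomy i l with h | h | h
    · simp [addRow, specialize, addRowSpecialize, h, hp.symm, h.not_gt]
    · simp [addRow, specialize, addRowSpecialize, h, hp.symm]
    · simp [addRow, specialize, addRowSpecialize, h, hp.symm, h.not_gt, h.ne']
  · simp [addRow, specialize, addRowSpecialize, hq]

variable [Fintype ι] [Fintype L]

lemma sum_mapDomain_mul {σ : Type*} [Fintype σ] (e : σ → σ) (m : σ →₀ ℕ) (W : σ → ℤ) :
    ∑ v, (Finsupp.mapDomain e m v : ℤ) * W v = ∑ v, (m v : ℤ) * W (e v) := by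
  have h1 := Finsupp.sum_mapDomain_index (f := e) (s := m) (h := fun v n => (n : ℤ) * W v)
    (by simp) (by intros; push_cast; ring)
  rwa [Finsupp.sum_fintype _ _ (by simp), Finsupp.sum_fintype _ _ (by simp)] at h1

section

variable {p p' : ι} (hp : p ≠ p') {l : L} {m μ : ι × L →₀ ℕ} {c : R}
  (h : Finsupp.mapDomain (mergeEntry p p' l) m ∈
    (aeval (addRowSpecialize R p p' l) (monomial μ c)).support)
include hp h

/-- The hypotheses bound the weight of each substituted variable. Indicator weights `W` then compare
individual exponents of `m` and `μ`. -/
lemma sum_le_of_mem_support_addRowSpecialize {W k : ι × L → ℤ}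
    (h1 : ∀ i, i < l → W (p, i) ≤ k (p, i)) (h2 : ∀ i, i < l → W (p', i) ≤ k (p, i))
    (h3 : W (p', l) ≤ k (p, l)) (h4 : ∀ i, l < i → W (p, i) ≤ k (p, i))
    (h5 : ∀ i, l < i → W (p, i) ≤ k (p', i)) (h6 : ∀ q i, q ≠ p → W (q, i) ≤ k (q, i)) :
    ∑ v, (m v : ℤ) * W (mergeEntry p p' l v) ≤ ∑ v, (μ v : ℤ) * k v := by
  rw [← sum_mapDomain_mul]
  refine WeightLE.aeval_monomial (W := W) (k := k) (fun v => ?_) μ c _ h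
  obtain ⟨q, i⟩ := v
  unfold addRowSpecialize
  split_ifs with a b b b
  · obtain rfl : q = p := a
    exact (WeightLE.var (h1 i b)).add (WeightLE.var (h2 i b))
  · obtain rfl : q = p := a
    obtain rfl : i = l := b
    exact WeightLE.var h3
  · obtain rfl : q = p := a
    refine WeightLE.var (h4 i ?_)
    simp only [] at *
    order
  · obtain ⟨rfl : q = p', b⟩ := b
    exact (WeightLE.var (h5 i b)).add (WeightLE.var (h6 _ i hp.symm))
  · exact WeightLE.var (h6 q i a)

/-- The substitution fixes these variables; testing the indicator weight and its negative gives both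
inequalities. -/
lemma eq_of_mem_support_addRowSpecialize_other (q : ι) (i : L) (hq : q ≠ p) (hq' : q ≠ p') :
    μ (q, i) = m (q, i) := by
  have key : ∀ v, mergeEntry p p' l v = (q, i) ↔ v = (q, i) := by
    rintro ⟨a, b⟩
    unfold mergeEntry
    split_ifs with hab
    · simp_all [Prod.ext_iff, eq_comm]
    · rfl
  have h1 := sum_le_of_mem_support_addRowSpecialize hp h
    (W := fun v => if v = (q, i) then 1 else 0) (k := fun v => if v = (q, i) then 1 else 0)
    (by simp [hq.symm]) (by simp [hq.symm, hq'.symm]) (by simp [hq.symm, hq'.symm])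
    (by simp) (by simp [hq.symm, hq'.symm]) (by simp)
  have h2 := sum_le_of_mem_support_addRowSpecialize hp h
    (W := fun v => if v = (q, i) then -1 else 0) (k := fun v => if v = (q, i) then -1 else 0)
    (by simp [hq.symm]) (by simp [hq.symm, hq'.symm]) (by simp [hq.symm, hq'.symm])
    (by simp) (by simp [hq.symm, hq'.symm]) (by simp)
  simp [key] at h1 h2
  omega

/-- Every variable of rows `p` and `p'` stays in its column and in these two rows, so the total
degree there is preserved. Again a weight and its negative are used. -/
lemma add_eq_of_mem_support_addRowSpecialize (i : L) :
    μ (p, i) + μ (p', i) = m (p, i) + m (p', i) := by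
  have key : ∀ c : ℤ, ∀ v, (if mergeEntry p p' l v = (p, i) then c else 0) +
      (if mergeEntry p p' l v = (p', i) then c else 0) =
      (if v = (p, i) then c else 0) + (if v = (p', i) then c else 0) := by
    rintro c ⟨a, b⟩
    unfold mergeEntry
    split_ifs <;> simp_all
  have h1 := sum_le_of_mem_support_addRowSpecialize hp h
    (W := fun v => (if v = (p, i) then 1 else 0) + (if v = (p', i) then 1 else 0))
    (k := fun v => (if v = (p, i) then 1 else 0) + (if v = (p', i) then 1 else 0))
    (by simp) (by simp [hp, hp.symm]) (by simp [hp, hp.symm]) (by simp)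
    (by simp [hp, hp.symm]) (by simp)
  have h2 := sum_le_of_mem_support_addRowSpecialize hp h
    (W := fun v => (if v = (p, i) then -1 else 0) + (if v = (p', i) then -1 else 0))
    (k := fun v => (if v = (p, i) then -1 else 0) + (if v = (p', i) then -1 else 0))
    (by simp) (by simp [hp, hp.symm]) (by simp [hp, hp.symm]) (by simp)
    (by simp [hp, hp.symm]) (by simp)
  simp only [key] at h1 h2
  simp [mul_add, Finset.sum_add_distrib] at h1 h2
  omega

/-- Before column `l`, the variable `(p, i)` arises only from itself. -/
lemma le_of_mem_support_addRowSpecialize_of_lt (i : L) (hi : i < l) : m (p, i) ≤ μ (p, i) := by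
  have key : ∀ v, mergeEntry p p' l v = (p, i) ↔ v = (p, i) := by
    rintro ⟨a, b⟩
    unfold mergeEntry
    split_ifs with hab
    · simp_all [hp.symm, hi.ne']
    · rfl
  have h1 := sum_le_of_mem_support_addRowSpecialize hp h
    (W := fun v => if v = (p, i) then 1 else 0) (k := fun v => if v = (p, i) then 1 else 0)
    (by simp) (by simp [hp.symm]; intros; split_ifs <;> simp) (by simp [hp.symm, hi.ne'])
    (by simp) (fun j hj => by simp [(hi.trans hj).ne']) (by simp)
  simpa [key] using h1

lemma le_of_mem_support_addRowSpecialize_of_gt (i : L) (hi : l < i) : m (p', i) ≤ μ (p', i) := by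
  have key : ∀ v, mergeEntry p p' l v = (p', i) ↔ v = (p', i) := by
    rintro ⟨a, b⟩
    unfold mergeEntry
    split_ifs with hab
    · simp_all [hi.ne]
    · rfl
  have h1 := sum_le_of_mem_support_addRowSpecialize hp h
    (W := fun v => if v = (p', i) then 1 else 0) (k := fun v => if v = (p', i) then 1 else 0)
    (by simp) (fun j hj => by simp [hp, (hj.trans hi).ne]) (by simp [hp, hi.ne])
    (by simp) (fun j hj => by simp [hp]; split_ifs <;> simp) (by simp)
  simpa [key] using h1

end

/-- For the weight `W` below, each variable goes to its merged variable plus terms of smaller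
weight. The image of the monomial therefore has the merged monomial as its top-weight part, and no
lower term can cancel it. -/
lemma coeff_addRowSpecialize_monomial {p p' : ι} (hp : p ≠ p') (l : L) (m : ι × L →₀ ℕ) (c : R) :
    coeff (Finsupp.mapDomain (mergeEntry p p' l) m)
      (aeval (addRowSpecialize R p p' l) (monomial m c)) = c := by
  let W : ι × L → ℤ := fun v =>
    (if v.1 = p ∧ v.2 < l then 1 else 0) + (if v.1 = p' ∧ l < v.2 then 1 else 0)
  have hW : ∀ v, W (mergeEntry p p' l v) = W v := by
    rintro ⟨a, b⟩
    by_cases hab : a = p ∧ b = l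
    · simp [W, mergeEntry, hab, hp]
    · simp [mergeEntry, hab]
  have h1 : ∀ v, WeightLE W (W v) (X (mergeEntry p p' l v) : MvPolynomial (ι × L) R) :=
    fun v => WeightLE.var (hW v).le
  have h2 : ∀ v, WeightLE W (W v - 1)
      (addRowSpecialize R p p' l v - X (mergeEntry p p' l v)) := by
    rintro ⟨q, i⟩
    by_cases hq : q = p
    · subst hq
      rcases lt_trichotomy i l with h | h | h
      · simp only [addRowSpecialize, mergeEntry, h, h.ne, if_true, and_false, if_false,
          add_sub_cancel_left]
        exact WeightLE.var (by simp [W, h, h.not_gt, hp.symm])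
      · simpa [addRowSpecialize, mergeEntry, h] using WeightLE.zero
      · simpa [addRowSpecialize, mergeEntry, h, h.ne', h.not_gt] using WeightLE.zero
    · by_cases hq' : q = p' ∧ l < i
      · obtain ⟨rfl, h⟩ := hq'
        simp only [addRowSpecialize, mergeEntry, h, hq, and_self, if_true, false_and, if_false,
          add_sub_cancel_right]
        exact WeightLE.var (by simp [W, h, h.not_gt, hp, hp.symm])
      · simpa [addRowSpecialize, mergeEntry, hq, hq'] using WeightLE.zero
  have h3 : ∀ v, WeightLE W (W v) (addRowSpecialize R p p' l v) := fun v => by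
    simpa using ((h2 v).mono (by linarith)).add (h1 v)
  have h4 := WeightLE.aeval_monomial_sub h3 h1 h2 m c
  have h5 : aeval (fun v => (X (mergeEntry p p' l v) : MvPolynomial (ι × L) R)) (monomial m c) =
      monomial (Finsupp.mapDomain (mergeEntry p p' l) m) c := by
    rw [← rename_monomial]
    congr 1
    ext1 v
    simp
  rw [h5] at h4
  by_contra hne
  have h6 := h4 (Finsupp.mapDomain (mergeEntry p p' l) m)
    (mem_support_iff.2 (by simpa [coeff_monomial, sub_eq_zero] using hne))
  rw [sum_mapDomain_mul] at h6
  simp only [hW] at h6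
  linarith

/-- Variables of row `p'` map to polynomials of weight at most one, all others to weight at most
zero. -/
lemma sum_le_of_mem_support_specialize {p p' : ι} (hp : p ≠ p') {l : L} {d μ : ι × L →₀ ℕ} {c : R}
    (h : d ∈ (aeval (specialize R p p' l) (monomial μ c)).support) :
    ∑ v, (d v : ℤ) * ((if v.1 = p' ∧ v.2 ≤ l then 1 else 0) +
      (if v.1 = p ∧ l < v.2 then 1 else 0)) ≤ ∑ v, (μ v : ℤ) * (if v.1 = p' then 1 else 0) := by
  refine WeightLE.aeval_monomial
    (W := fun v => (if v.1 = p' ∧ v.2 ≤ l then 1 else 0) + (if v.1 = p ∧ l < v.2 then 1 else 0))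
    (k := fun v => if v.1 = p' then 1 else 0) (fun v => ?_) μ c _ h
  obtain ⟨q, i⟩ := v
  by_cases hq : q = p
  · subst hq
    rcases lt_trichotomy i l with hi | hi | hi
    · simpa [specialize, hi, hp] using WeightLE.var (by simp [hp, hi.not_gt])
    · simpa [specialize, hi] using WeightLE.zero
    · simpa [specialize, hi, hi.ne', hi.not_gt, hp] using
        (WeightLE.var (by simp [hp.symm, hi.not_ge])).neg
  · by_cases hq' : q = p'
    · subst hq'
      by_cases hi : l < i
      · simpa [specialize, hq, hi] using
          (WeightLE.var (by simp [hp, hi])).add (WeightLE.var (by simp [hp.symm, hi.not_ge]))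
      · simpa [specialize, hq, hi] using WeightLE.var (by simp [hq]; split_ifs <;> simp)
    · simpa [specialize, hq, hq'] using WeightLE.var (by simp [hq, hq'])

/-- The lattice word condition for the leading exponent `m` of a polynomial `F` which is invariant
under adding row `p'` to row `p`. -/
theorem sum_le_sum_of_addRow_invariant {p p' : ι} (hp : p ≠ p') {F : MvPolynomial (ι × L) R}
    (hF : aeval (addRow R p p') F = F) {w : ℕ}
    (hw : ∀ μ ∈ F.support, ∑ i, μ (p, i) = w ∧ ∑ i, μ (p', i) = w)
    {m : ι × L →₀ ℕ} (hm : m ∈ F.support)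
    (hmax : ∀ μ ∈ F.support, (∀ q i, q ≠ p → q ≠ p' → μ (q, i) = m (q, i)) →
      (∀ i, μ (p, i) + μ (p', i) = m (p, i) + m (p', i)) →
      ∀ l, (∀ i < l, μ (p, i) = m (p, i)) → μ (p, l) ≤ m (p, l)) (l : L) :
    ∑ i with i ≤ l, m (p', i) ≤ ∑ i with i < l, m (p, i) := by
  classical
  have hcoeff : coeff (Finsupp.mapDomain (mergeEntry p p' l) m)
      (aeval (addRowSpecialize R p p' l) F) = coeff m F := by
    conv_lhs => rw [F.as_sum, map_sum, coeff_sum]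
    rw [Finset.sum_eq_single_of_mem m hm, coeff_addRowSpecialize_monomial hp]
    intro μ hμ hne
    by_contra hM
    have hM := mem_support_iff.2 hM
    have ho := eq_of_mem_support_addRowSpecialize_other hp hM
    have hc := add_eq_of_mem_support_addRowSpecialize hp hM
    have hlt := le_of_mem_support_addRowSpecialize_of_lt hp hM
    have hgt := le_of_mem_support_addRowSpecialize_of_gt hp hM
    have hmax' := hmax μ hμ ho hc
    -- Maximality bounds `μ` from above in the first column not yet settled; `hlt` bounds it from
    -- below.
    have heq : ∀ i, i < l → μ (p, i) = m (p, i) := by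
      intro i
      induction i using WellFoundedLT.induction with
      | ind i ih =>
        intro hi
        exact (hmax' i fun j hj => ih j hj (hj.trans hi)).antisymm (hlt i hi)
    have hle : ∀ i ∈ Finset.univ, μ (p, i) ≤ m (p, i) := by
      intro i _
      rcases lt_trichotomy i l with h | rfl | h
      · exact (heq i h).le
      · exact hmax' i heq
      · have := hc i
        have := hgt i h
        omega
    -- Rows `p` of `μ` and `m` have equal sums, so the termwise inequality is an equality.
    have hall := (Finset.sum_eq_sum_iff_of_le hle).1 ((hw μ hμ).1.trans (hw m hm).1.symm)
    apply hne
    ext ⟨q, i⟩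
    have h1 := hall i (Finset.mem_univ i)
    by_cases hq : q = p
    · rw [hq, h1]
    by_cases hq' : q = p'
    · have := hc i
      rw [hq']
      omega
    · exact ho q i hq hq'
  rw [← aeval_specialize_addRow hp, hF] at hcoeff
  obtain ⟨μ, hμ, hM⟩ := exists_mem_support_of_coeff_aeval_ne_zero
    (hcoeff.trans_ne (mem_support_iff.1 hm))
  have key := sum_le_of_mem_support_specialize hp hM
  rw [sum_mapDomain_mul] at key
  -- The merged entry `(p', l)` has weight one, so column `l` of row `p` is counted as well. This is
  -- the source of the strict `i < l` in the conclusion.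
  have hmerge : ∀ v : ι × L,
      ((if (mergeEntry p p' l v).1 = p' ∧ (mergeEntry p p' l v).2 ≤ l then 1 else 0) +
        (if (mergeEntry p p' l v).1 = p ∧ l < (mergeEntry p p' l v).2 then 1 else 0) : ℤ) =
      (if v.1 = p' ∧ v.2 ≤ l then 1 else 0) + (if v.1 = p ∧ ¬ v.2 < l then 1 else 0) := by
    rintro ⟨q, i⟩
    by_cases hqi : q = p ∧ i = l
    · simp [mergeEntry, hqi, hp, hp.symm]
    · have : (q = p ∧ l < i) ↔ (q = p ∧ ¬ i < l) := by
        rw [not_lt]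
        exact and_congr_right fun h => ⟨le_of_lt, fun h' => lt_of_le_of_ne h' fun e => hqi ⟨h, e.symm⟩⟩
      simp only [mergeEntry, hqi, if_false, this]
  simp only [hmerge] at key
  simp only [Fintype.sum_prod_type_right, mul_add, Finset.sum_add_distrib, ite_and,
    mul_ite, mul_one, mul_zero, Finset.sum_ite_eq', Finset.mem_univ, if_true] at key
  simp only [← Finset.sum_filter] at key
  have hw1 := (hw m hm).1
  rw [← Finset.sum_filter_add_sum_filter_not _ (fun i => i < l)] at hw1
  have hw2 := (hw μ hμ).2
  zify at hw1 hw2 ⊢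
  linarith

end Ballot

/-! ### From row contents to semistandard tableaux and links -/

section Tableaux

/-- A function on a finite linear order with sum `w` is the content of a weakly increasing word of
length `w`. -/
lemma exists_monotone_card_fiber_eq {L : Type*} [LinearOrder L] [Fintype L] (m : L → ℕ) {w : ℕ}
    (hw : ∑ i, m i = w) :
    ∃ t : Fin w → L, Monotone t ∧ ∀ i, (Finset.univ.filter fun c => t c = i).card = m i := by
  classical
  let S : Multiset L := ∑ i, m i • ({i} : Multiset L)
  have hS : (S.sort (· ≤ ·)).length = w := by
    rw [Multiset.length_sort, ← hw]
    simp [S]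
  subst hS
  refine ⟨(S.sort (· ≤ ·)).get, (S.pairwise_sort (· ≤ ·)).sortedLE.monotone_get, fun i => ?_⟩
  have h1 : Multiset.map (S.sort (· ≤ ·)).get Finset.univ.val = S := by
    rw [Fin.univ_val_map, List.ofFn_get, Multiset.sort_eq]
  have h2 : Multiset.count i S = m i := by
    simp [S, Multiset.count_sum', Multiset.count_singleton]
  rw [← h2]
  conv_rhs => rw [← h1]
  rw [Multiset.count_map]
  simp [Finset.card, eq_comm]

lemma card_filter_comp_eq_sum {α L : Type*} [Fintype α] [Fintype L] [DecidableEq L] {t : α → L}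
    {m : L → ℕ} (h : ∀ i, (Finset.univ.filter fun c => t c = i).card = m i)
    (P : L → Prop) [DecidablePred P] :
    (Finset.univ.filter fun c => P (t c)).card = ∑ i with P i, m i := by
  rw [Finset.card_eq_sum_card_fiberwise (f := t) (t := Finset.univ.filter P)
    (fun c hc => by simpa using hc)]
  refine Finset.sum_congr rfl fun i hi => ?_
  rw [← h, Finset.filter_filter]
  congr 1
  ext c
  simp only [Finset.mem_filter, Finset.mem_univ, true_and] at hi ⊢
  exact ⟨fun h => h.2, fun h => ⟨h ▸ hi, h⟩⟩

/-- A lattice word condition on the contents of the rows yields a semistandard tableau. -/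
lemma exists_isSemistandard {L : Type} [LinearOrder L] [Fintype L] {r w : ℕ} (m : Fin r → L → ℕ)
    (hw : ∀ p, ∑ i, m p i = w)
    (hm : ∀ p p', p < p' → ∀ l, ∑ i with i ≤ l, m p' i ≤ ∑ i with i < l, m p i) :
    ∃ T : Tableau r w L, IsSemistandard T ∧
      ∀ p i, (Finset.univ.filter fun c => T p c = i).card = m p i := by
  choose T hT hcard using fun p => exists_monotone_card_fiber_eq (m p) (hw p)
  refine ⟨T, ⟨hT, fun c p p' hp => ?_⟩, hcard⟩
  by_contra hlt
  have hle : T p' c ≤ T p c := not_lt.1 hlt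
  -- At a violation in column `c`, take `l = T p' c`: row `p'` has at least `c + 1` entries `≤ l`,
  -- while row `p` has at most `c` entries `< l`.
  have h := hm p p' hp (T p' c)
  rw [← card_filter_comp_eq_sum (hcard p') (fun i => i ≤ T p' c),
    ← card_filter_comp_eq_sum (hcard p) (fun i => i < T p' c)] at h
  have h1 : Finset.Iic c ⊆ Finset.univ.filter fun c' => T p' c' ≤ T p' c := by
    intro c' hc'
    simpa using hT p' (Finset.mem_Iic.1 hc')
  have h2 : (Finset.univ.filter fun c' => T p c' < T p' c) ⊆ Finset.Iio c := by
    intro c' hc'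
    simp only [Finset.mem_filter, Finset.mem_univ, true_and] at hc'
    exact Finset.mem_Iio.2 (lt_of_not_ge fun h => (hc'.trans_le hle).not_ge (hT p h))
  have h3 := Finset.card_le_card h1
  have h4 := Finset.card_le_card h2
  simp at h3 h4
  omega

lemma prod_X_eq_monomial {β σ R : Type*} [Fintype β] [Fintype σ] [DecidableEq σ] [CommRing R]
    {g : β → σ} {m : σ →₀ ℕ} (h : ∀ v, (Finset.univ.filter fun b => g b = v).card = m v) :
    ∏ b, (X (g b) : MvPolynomial σ R) = monomial m 1 := by
  rw [← Finset.prod_fiberwise' Finset.univ g, monomial_eq, Finsupp.prod_fintype _ _ (by simp)]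
  simp [h]

lemma exists_equiv_of_card_fiber_eq {β γ σ : Type*} [Fintype β] [Fintype γ] [DecidableEq σ]
    {g : β → σ} {g' : γ → σ} (h : ∀ v, (Finset.univ.filter fun b => g b = v).card =
      (Finset.univ.filter fun b => g' b = v).card) :
    ∃ φ : β ≃ γ, ∀ b, g' (φ b) = g b := by
  have hv : ∀ v, Nonempty ({b // g b = v} ≃ {b // g' b = v}) := fun v =>
    ⟨Fintype.equivOfCardEq (by rw [Fintype.card_subtype, Fintype.card_subtype, h v])⟩
  refine ⟨(Equiv.sigmaFiberEquiv g).symm.trans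
    ((Equiv.sigmaCongrRight fun v => (hv v).some).trans (Equiv.sigmaFiberEquiv g')), fun b => ?_⟩
  exact ((hv (g b)).some ⟨b, rfl⟩).2

/-- The leading exponent of a polynomial which is invariant under row operations is the content of
a semistandard tableau. -/
theorem exists_isSemistandard_of_addRow_invariant {σ R : Type*} {L : Type} [LinearOrder σ]
    [Fintype σ] [LinearOrder L] [Fintype L] [CommRing R] {r w : ℕ} (e : σ ≃ Fin r × L)
    (he : StrictMono e.symm) {f : MvPolynomial σ R} (hf0 : f ≠ 0)
    (hf : ∀ p p', p < p' → aeval (fun v => rename e.symm (addRow R p p' (e v))) f = f)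
    (hw : ∀ μ ∈ f.support, ∀ p, ∑ i, μ (e.symm (p, i)) = w) :
    ∃ T : Tableau r w L, IsSemistandard T ∧
      ∀ v, (Finset.univ.filter fun b : Fin r × Fin w => e.symm (b.1, T b.1 b.2) = v).card =
        MonomialOrder.lex.degree f v := by
  set m := MonomialOrder.lex.degree f with hm
  obtain ⟨T, hT, hcard⟩ := exists_isSemistandard (fun p i => m (e.symm (p, i)))
    (hw m (MonomialOrder.lex.degree_mem_support hf0)) (fun p p' hp l => by
      have hinj : Function.Injective e := e.injective
      have hmap : ∀ (μ : σ →₀ ℕ) x, Finsupp.mapDomain e μ x = μ (e.symm x) := fun μ x => by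
        conv_lhs => rw [← e.apply_symm_apply x]
        exact Finsupp.mapDomain_apply hinj _ _
      have hsupp : ∀ μ ∈ (rename e f).support, ∃ μ' ∈ f.support, Finsupp.mapDomain e μ' = μ := by
        classical
        intro μ hμ
        rw [support_rename_of_injective hinj] at hμ
        simpa using hμ
      have := sum_le_sum_of_addRow_invariant (p := p) (p' := p') hp.ne (F := rename e f) (w := w)
        (m := Finsupp.mapDomain e m) ?_ ?_ ?_ ?_ l
      · simpa only [hmap] using this
      · conv_rhs => rw [← hf p p' hp]
        rw [aeval_rename, ← AlgHom.comp_apply (rename e)]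
        congr 1
        ext1 v
        rw [aeval_X, AlgHom.comp_apply, aeval_X, rename_rename]
        simp
      · intro μ hμ
        obtain ⟨μ, hμ', rfl⟩ := hsupp _ hμ
        simp only [hmap]
        exact ⟨hw μ hμ' p, hw μ hμ' p'⟩
      · rw [mem_support_iff, coeff_rename_mapDomain _ hinj]
        exact mem_support_iff.1 (MonomialOrder.lex.degree_mem_support hf0)
      · intro μ hμ
        obtain ⟨μ, hμ', rfl⟩ := hsupp _ hμ
        simp only [hmap]
        intro ho hc l hl
        by_contra! hlt
        have hle := MonomialOrder.lex.le_degree hμ'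
        rw [← hm, MonomialOrder.lex_le_iff] at hle
        refine hle.not_gt (Finsupp.Lex.lt_iff.2 ⟨e.symm (p, l), fun v hv => ?_, hlt⟩)
        obtain ⟨⟨q, i⟩, rfl⟩ := e.symm.surjective v
        -- Monotonicity of `e.symm` for the product order suffices: an entry of row `p` or `p'` in a
        -- column `≥ l` does not precede `(p, l)`. Thus `μ` and `m` agree before `(p, l)`, and `μ`
        -- would exceed the leading exponent.
        have hi : q = p ∨ q = p' → i < l := fun hq => by
          by_contra! hi
          refine hv.not_ge (he.monotone ⟨?_, hi⟩)
          rcases hq with rfl | rfl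
          exacts [le_rfl, hp.le]
        show m _ = μ _
        by_cases hq : q = p
        · subst hq
          exact (hl i (hi (Or.inl rfl))).symm
        by_cases hq' : q = p'
        · subst hq'
          have h1 := hl i (hi (Or.inr rfl))
          have h2 := hc i
          omega
        · exact (ho q i hq hq').symm)
  refine ⟨T, hT, fun v => ?_⟩
  obtain ⟨⟨q, i⟩, rfl⟩ := e.symm.surjective v
  rw [← hcard q i, ← Finset.card_map ⟨fun c : Fin w => (q, c), Prod.mk_right_injective q⟩]
  congr 1
  ext ⟨a, c⟩
  simp only [Finset.mem_filter, Finset.mem_univ, true_and, Finset.mem_map, e.symm.injective.eq_iff,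
    Function.Embedding.coeFn_mk, Prod.mk.injEq]
  constructor
  · rintro ⟨rfl, h⟩
    exact ⟨c, h, rfl, rfl⟩
  · rintro ⟨c, h, rfl, rfl⟩
    exact ⟨rfl, h⟩

end Tableaux

/-! ### Row and column operations as elements of the group -/

section SemiInvariants

variable {K r₀ r₁ : ℕ}

/-- The coordinate `(i, j, k)` as the entry with label `(i, k)` in row `j`. -/
def rowEquiv (K r₀ r₁ : ℕ) : Coord K r₀ r₁ ≃ Fin r₁ × Label K r₀ where
  toFun v := ((ofLex (ofLex v).2).1, toLex ((ofLex v).1, (ofLex (ofLex v).2).2))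
  invFun b := coord b.2.arrow b.1 b.2.index
  left_inv _ := rfl
  right_inv _ := rfl

/-- The coordinate `(i, j, k)` as the entry with label `(i, j)` in row `k`. -/
def columnEquiv (K r₀ r₁ : ℕ) : Coord K r₀ r₁ ≃ Fin r₀ × Label K r₁ where
  toFun v := ((ofLex (ofLex v).2).2, toLex ((ofLex v).1, (ofLex (ofLex v).2).1))
  invFun b := coord b.2.arrow b.2.index b.1
  left_inv _ := rfl
  right_inv _ := rfl

lemma coord_le_coord {i i' : Fin K} {j j' : Fin r₁} {k k' : Fin r₀} :
    coord i j k ≤ coord i' j' k' ↔ i < i' ∨ i = i' ∧ (j < j' ∨ j = j' ∧ k ≤ k') := by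
  simp [coord, Prod.Lex.le_iff]

lemma label_le_label {r : ℕ} {a b : Label K r} :
    a ≤ b ↔ a.arrow < b.arrow ∨ a.arrow = b.arrow ∧ a.index ≤ b.index := by
  simp [Label.arrow, Label.index, Prod.Lex.le_iff]

lemma strictMono_rowEquiv_symm : StrictMono (rowEquiv K r₀ r₁).symm := by
  refine Monotone.strictMono_of_injective (fun a b h => ?_) (Equiv.injective _)
  obtain ⟨h1, h2⟩ := h
  refine coord_le_coord.2 ?_
  rw [label_le_label] at h2
  rcases h2 with h2 | ⟨h2, h3⟩
  · exact Or.inl h2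
  · exact Or.inr ⟨h2, h1.lt_or_eq.imp_right fun h => ⟨h, h3⟩⟩

lemma strictMono_columnEquiv_symm : StrictMono (columnEquiv K r₀ r₁).symm := by
  refine Monotone.strictMono_of_injective (fun a b h => ?_) (Equiv.injective _)
  obtain ⟨h1, h2⟩ := h
  refine coord_le_coord.2 ?_
  rw [label_le_label] at h2
  rcases h2 with h2 | ⟨h2, h3⟩
  · exact Or.inl h2
  · exact Or.inr ⟨h2, h3.lt_or_eq.imp_right fun h => ⟨h, h1⟩⟩

/-- An elementary matrix of determinant one as an element of `GL`. -/
def transvectionGL {r : ℕ} (p p' : Fin r) (h : p ≠ p') : GL (Fin r) ℂ :=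
  Matrix.GeneralLinearGroup.mkOfDetNeZero (Matrix.transvection p p' 1)
    (by simp [Matrix.det_transvection_of_ne p p' h])

/-- A diagonal matrix whose only entry different from `1` is a `2` in position `p`. -/
def doubleGL {r : ℕ} (p : Fin r) : GL (Fin r) ℂ :=
  Matrix.GeneralLinearGroup.mkOfDetNeZero (Matrix.diagonal fun q => if q = p then 2 else 1)
    (by simp [Matrix.det_diagonal])

lemma coe_transvectionGL {r : ℕ} {p p' : Fin r} (h : p ≠ p') :
    (transvectionGL p p' h : Matrix (Fin r) (Fin r) ℂ) = Matrix.transvection p p' 1 := rfl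

lemma coe_doubleGL {r : ℕ} (p : Fin r) :
    (doubleGL p : Matrix (Fin r) (Fin r) ℂ) = Matrix.diagonal fun q => if q = p then 2 else 1 := rfl

lemma det_doubleGL {r : ℕ} (p : Fin r) : (doubleGL p : Matrix (Fin r) (Fin r) ℂ).det = 2 := by
  simp [coe_doubleGL, Matrix.det_diagonal]

lemma map_transvection {r : ℕ} {R S : Type*} [CommRing R] [CommRing S] (φ : R →+* S)
    (p p' : Fin r) :
    (Matrix.transvection p p' (1 : R)).map φ = Matrix.transvection p p' 1 := by
  simp [Matrix.transvection, Matrix.map_add, Matrix.map_single]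

lemma changeBasis_transvection_row {p p' : Fin r₁} (h : p ≠ p') :
    changeBasis (K := K) ((1 : GL (Fin r₀) ℂ), transvectionGL p p' h) =
      aeval (fun v => rename (rowEquiv K r₀ r₁).symm (addRow ℂ p p' (rowEquiv K r₀ r₁ v))) := by
  unfold changeBasis
  congr 1
  ext1 v
  obtain ⟨⟨j, i⟩, rfl⟩ := (rowEquiv K r₀ r₁).symm.surjective v
  simp only [transformedMatrix, coe_transvectionGL, map_transvection, inv_one, Units.val_one,
    Matrix.map_one _ (map_zero C) (map_one C), Matrix.mul_one, Equiv.apply_symm_apply]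
  by_cases hj : j = p
  · subst hj
    simp only [addRow, if_true, map_add, rename_X]
    exact (Matrix.transvection_mul_apply_same ..).trans (by rw [one_mul]; rfl)
  · simp only [addRow, hj, if_false, rename_X]
    exact Matrix.transvection_mul_apply_of_ne _ _ _ _ hj _ _

lemma changeBasis_transvection_column {p p' : Fin r₀} (h : p ≠ p') :
    changeBasis (K := K) ((transvectionGL p' p h.symm)⁻¹, (1 : GL (Fin r₁) ℂ)) =
      aeval (fun v =>
        rename (columnEquiv K r₀ r₁).symm (addRow ℂ p p' (columnEquiv K r₀ r₁ v))) := by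
  unfold changeBasis
  congr 1
  ext1 v
  obtain ⟨⟨j, i⟩, rfl⟩ := (columnEquiv K r₀ r₁).symm.surjective v
  simp only [transformedMatrix, coe_transvectionGL, map_transvection, inv_inv, Units.val_one,
    Matrix.map_one _ (map_zero C) (map_one C), Matrix.one_mul, Equiv.apply_symm_apply]
  by_cases hj : j = p
  · subst hj
    simp only [addRow, if_true, map_add, rename_X]
    exact (Matrix.mul_transvection_apply_same ..).trans (by rw [one_mul]; rfl)
  · simp only [addRow, hj, if_false, rename_X]
    exact Matrix.mul_transvection_apply_of_ne _ _ _ _ hj _ _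

lemma changeBasis_double_row (p : Fin r₁) :
    changeBasis (K := K) ((1 : GL (Fin r₀) ℂ), doubleGL p) =
      aeval (fun v => C (if (rowEquiv K r₀ r₁ v).1 = p then 2 else 1) * X v) := by
  unfold changeBasis
  congr 1
  ext1 v
  simp only [transformedMatrix, coe_doubleGL, Matrix.diagonal_map (map_zero C), inv_one,
    Units.val_one, Matrix.map_one _ (map_zero C) (map_one C), Matrix.mul_one]
  exact Matrix.diagonal_mul _ _ _ _

lemma changeBasis_double_column (p : Fin r₀) :
    changeBasis (K := K) ((doubleGL p)⁻¹, (1 : GL (Fin r₁) ℂ)) =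
      aeval (fun v => C (if (columnEquiv K r₀ r₁ v).1 = p then 2 else 1) * X v) := by
  unfold changeBasis
  congr 1
  ext1 v
  simp only [transformedMatrix, coe_doubleGL, Matrix.diagonal_map (map_zero C), inv_inv,
    Units.val_one, Matrix.map_one _ (map_zero C) (map_one C), Matrix.one_mul]
  exact (Matrix.mul_diagonal _ _ _ _).trans (mul_comm _ _)

/-- The monomials of an eigenvector of the torus doubling the variables of one row all have the
same degree in these variables. -/
lemma sum_eq_of_aeval_double_eq {σ : Type*} {L : Type} [Fintype σ] [Fintype L] {r : ℕ}
    (e : σ ≃ Fin r × L) {p : Fin r} {f : MvPolynomial σ ℂ} {n : ℤ}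
    (h : aeval (fun v => (C (if (e v).1 = p then 2 else 1) * X v : MvPolynomial σ ℂ)) f =
      C ((2 : ℂ) ^ n) * f) {μ : σ →₀ ℕ} (hμ : μ ∈ f.support) :
    ((∑ i, μ (e.symm (p, i)) : ℕ) : ℤ) = n := by
  classical
  have key : ∀ ν : σ →₀ ℕ, ∀ c : ℂ,
      aeval (fun v => (C (if (e v).1 = p then 2 else 1) * X v : MvPolynomial σ ℂ)) (monomial ν c) =
      monomial ν (2 ^ (∑ i, ν (e.symm (p, i))) * c) := by
    intro ν c
    have h1 : ∏ v, (if (e v).1 = p then (2 : ℂ) else 1) ^ ν v = 2 ^ (∑ i, ν (e.symm (p, i))) := by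
      rw [← e.symm.prod_comp, Fintype.prod_prod_type]
      simp only [Equiv.apply_symm_apply]
      rw [Finset.prod_eq_single p (fun q _ hq => by simp [hq]) (by simp)]
      simp [Finset.prod_pow_eq_pow_sum]
    rw [aeval_monomial, Finsupp.prod_fintype _ _ (by simp)]
    simp only [mul_pow, Finset.prod_mul_distrib, ← map_pow, ← map_prod, h1]
    rw [monomial_eq, Finsupp.prod_fintype _ _ (by simp), algebraMap_eq, C_mul]
    ring
  have h2 := congrArg (coeff μ) h
  rw [coeff_C_mul] at h2
  conv_lhs at h2 => rw [f.as_sum, map_sum, coeff_sum]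
  simp only [key, coeff_monomial] at h2
  rw [Finset.sum_ite_eq' f.support μ, if_pos hμ] at h2
  have h3 := mul_right_cancel₀ (mem_support_iff.1 hμ) h2
  rw [← zpow_natCast] at h3
  -- Norms reduce the comparison to real powers of `2`, where the exponent is determined.
  have h4 := congrArg norm h3
  rw [norm_zpow, norm_zpow, Complex.norm_ofNat] at h4
  exact zpow_right_injective₀ (by norm_num) (by norm_num) h4

end SemiInvariants

end Kronecker

end

/-! ### Assembling the linked pair -/

theorem mainTheorem4 (K r₀ r₁ : ℕ) (θ : ℤ × ℤ) (f : Kronecker.CoordRing K r₀ r₁)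
    (hf : Kronecker.IsSemiInvariant θ f) (hf0 : f ≠ 0) :
    ∃ (wp wm : ℕ) (Tp : Kronecker.Tableau r₁ wp (Kronecker.Label K r₀))
      (Tm : Kronecker.Tableau r₀ wm (Kronecker.Label K r₁)),
      Kronecker.IsSemistandardLinkedPair Tp Tm ∧
      Kronecker.leadingMonomial f = Kronecker.monPlus Tp ∧
      Kronecker.leadingMonomial f = Kronecker.monMinus Tm := by
  -- If there is a row, its degree equals `θ.2`, which is then nonnegative; with no rows the claim
  -- is vacuous. So `toNat` loses nothing, and likewise for `-θ.1`, whose sign comes from the action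
  -- by `g₀⁻¹`.
  open Kronecker MvPolynomial in
  have hrow : ∀ μ ∈ f.support, ∀ p, ∑ i, μ ((rowEquiv K r₀ r₁).symm (p, i)) = θ.2.toNat := by
    intro μ hμ p
    have h := hf (1, doubleGL p)
    rw [changeBasis_double_row] at h
    have := sum_eq_of_aeval_double_eq (rowEquiv K r₀ r₁) (n := θ.2)
      (by simpa [character, det_doubleGL] using h) hμ
    omega
  have hcol : ∀ μ ∈ f.support, ∀ p,
      ∑ i, μ ((columnEquiv K r₀ r₁).symm (p, i)) = (-θ.1).toNat := by
    intro μ hμ p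
    have h := hf ((doubleGL p)⁻¹, 1)
    rw [changeBasis_double_column] at h
    have := sum_eq_of_aeval_double_eq (columnEquiv K r₀ r₁) (n := -θ.1)
      (by simpa [character, det_doubleGL, Matrix.det_nonsing_inv] using h) hμ
    omega
  obtain ⟨Tp, hTp, hp⟩ := exists_isSemistandard_of_addRow_invariant (rowEquiv K r₀ r₁)
    strictMono_rowEquiv_symm hf0 (fun p p' h => by
      rw [← changeBasis_transvection_row h.ne, hf]
      simp [character, coe_transvectionGL, Matrix.det_transvection_of_ne _ _ h.ne]) hrow
  obtain ⟨Tm, hTm, hm⟩ := exists_isSemistandard_of_addRow_invariant (columnEquiv K r₀ r₁)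
    strictMono_columnEquiv_symm hf0 (fun p p' h => by
      rw [← changeBasis_transvection_column h.ne, hf]
      simp [character, coe_transvectionGL, Matrix.det_nonsing_inv,
        Matrix.det_transvection_of_ne _ _ h.ne']) hcol
  refine ⟨_, _, Tp, Tm, ⟨?_, hTp, hTm⟩, ?_, ?_⟩
  · obtain ⟨φ, hφ⟩ := exists_equiv_of_card_fiber_eq fun v => (hp v).trans (hm v).symm
    refine ⟨φ, fun b => ?_⟩
    have h := hφ b
    simp only [rowEquiv, columnEquiv, Equiv.coe_fn_symm_mk, coord, toLex_inj, Prod.mk.injEq] at h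
    exact ⟨h.1.symm, h.2.1.symm, h.2.2⟩
  · rw [leadingMonomial, ← prod_X_eq_monomial hp, Fintype.prod_prod_type]
    rfl
  · rw [leadingMonomial, ← prod_X_eq_monomial hm, Fintype.prod_prod_type]
    rfl
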